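/- There exist absolute constants $c, C_1, C_2 > 0$ such that the following holds. Let $d \ge 1$, let $G=(V,E)$ be a finite simple $d$-regular graph on $n \ge 1$ vertices, and let $k$ be a real number with $k \ge c\log^9 n$, where $\log = \log_2$. For $J \subseteq V$, the edge density of the induced subgraph $G[J]$ is $|E(G[J])| / \binom{|J|}{2}$ (taken to be $0$ when $|J| \le 1$). Then the number of subsets $J \subseteq V$ such that $G[J]$ has edge density at most $\frac{1}{k}\cdot\frac{d}{n}$ is at most $$2^{\frac{n}{2}\left(1 + C_1\frac{\log^3 n}{d} + C_2\frac{\log^3 n}{k^{1/3}}\right)}.$$ -/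

import Mathlib

/-- Edge density of the subgraph `G[J]` induced by the vertex set `J`: the number of edges of `G`
with both endpoints in `J`, divided by `|J| choose 2`. If `|J| ≤ 1` there are no edges and the
value is `0`. -/
noncomputable def inducedDensity {V : Type*} (G : SimpleGraph V) (J : Finset V) : ℝ :=
  ((G.induce (J : Set V)).edgeSet.ncard : ℝ) / ((J.card.choose 2 : ℕ) : ℝ)

/-! Put `κ = k^(1/3)`. A sparse `J` has induced degree sum at most `dn/κ³`, so at most `n/κ` of its
vertices have more than `d/κ²` neighbours in `J`. These exceptional vertices cost a factor
`(n+1)^(n/κ)`; the rest of `J` has all induced degrees at most `t = ⌊d/κ²⌋`. To count such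
bounded-degree sets, `sq_card_isDegreeBounded_le` replaces pairs of them by pairs `(A, B)` in which
each vertex of `B` has at most `2t` neighbours in `A`. Summing over `B` first leaves a sum over `A`
of a product of local weights on `A ∩ N(v)`, and a Hölder inequality for `d`-fold covers
(`Finset.sum_powerset_prod_le_prod_rpow`) bounds it one neighbourhood at a time. -/

/-! ### Hölder-type inequalities -/

/-- Divide by the right side and apply AM-GM to the ratios `p/(p+q)` and `q/(p+q)`; the two
arithmetic means add up to 1. -/
theorem Real.prod_rpow_add_prod_rpow_le {ι : Type*} (T : Finset ι) (p q : ι → ℝ)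
    (hT : T.Nonempty) (hp : ∀ i ∈ T, 0 < p i) (hq : ∀ i ∈ T, 0 < q i) :
    ∏ i ∈ T, p i ^ (1 / (T.card : ℝ)) + ∏ i ∈ T, q i ^ (1 / (T.card : ℝ)) ≤
      ∏ i ∈ T, (p i + q i) ^ (1 / (T.card : ℝ)) := by
  have hc : (0 : ℝ) < T.card := by exact_mod_cast hT.card_pos
  have hw : ∑ _i ∈ T, 1 / (T.card : ℝ) = 1 := by
    rw [Finset.sum_const, nsmul_eq_mul]; field_simp
  have key : ∀ r : ι → ℝ, (∀ i ∈ T, 0 < r i) →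
      ∏ i ∈ T, r i ^ (1 / (T.card : ℝ)) ≤ (∏ i ∈ T, (p i + q i) ^ (1 / (T.card : ℝ))) *
        ∑ i ∈ T, 1 / (T.card : ℝ) * (r i / (p i + q i)) := by
    intro r hr
    have hpq : ∀ i ∈ T, 0 < p i + q i := fun i hi => add_pos (hp i hi) (hq i hi)
    have h1 : ∏ i ∈ T, r i ^ (1 / (T.card : ℝ)) =
        (∏ i ∈ T, (p i + q i) ^ (1 / (T.card : ℝ))) *
          ∏ i ∈ T, (r i / (p i + q i)) ^ (1 / (T.card : ℝ)) := by
      rw [← Finset.prod_mul_distrib]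
      refine Finset.prod_congr rfl fun i hi => ?_
      rw [← Real.mul_rpow (hpq i hi).le (div_pos (hr i hi) (hpq i hi)).le,
        mul_div_cancel₀ _ (hpq i hi).ne']
    rw [h1]
    refine mul_le_mul_of_nonneg_left ?_
      (Finset.prod_nonneg fun i hi => Real.rpow_nonneg (hpq i hi).le _)
    exact Real.geom_mean_le_arith_mean_weighted T _ _ (fun i _ => by positivity) hw
      (fun i hi => (div_pos (hr i hi) (hpq i hi)).le)
  refine (add_le_add (key p hp) (key q hq)).trans_eq ?_
  have hs : ∑ i ∈ T, (1 / (T.card : ℝ) * (p i / (p i + q i)) +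
      1 / (T.card : ℝ) * (q i / (p i + q i))) = 1 := by
    refine (Finset.sum_congr rfl fun i hi => ?_).trans hw
    have := (add_pos (hp i hi) (hq i hi)).ne'
    field_simp
  rw [← mul_add, ← Finset.sum_add_distrib, hs, mul_one]

/-- By induction on `S`: a new point `x` splits the sum by whether `x ∈ A`. Only the `d` factors
with `x ∈ N i` differ between the halves, and superadditivity of the geometric mean recombines them.
-/
theorem Finset.sum_powerset_prod_le_prod_rpow {α ι : Type*} [DecidableEq α] [Fintype ι]
    (N : ι → Finset α) (d : ℕ) (hd : 1 ≤ d) (S : Finset α)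
    (hN : ∀ x ∈ S, (Finset.univ.filter fun i => x ∈ N i).card = d)
    (f : ι → Finset α → ℝ) (hf : ∀ i a, 0 < f i a) :
    ∑ A ∈ S.powerset, ∏ i, f i (A ∩ N i) ≤
      ∏ i, (∑ a ∈ (S ∩ N i).powerset, f i a ^ d) ^ (1 / (d : ℝ)) := by
  induction S using Finset.induction_on generalizing f with
  | empty =>
    simp only [Finset.powerset_empty, Finset.sum_singleton, Finset.empty_inter]
    refine le_of_eq (Finset.prod_congr rfl fun i _ => ?_)
    rw [one_div, Real.pow_rpow_inv_natCast (hf _ _).le (by omega)]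
  | insert x S hx ih =>
    have hN' : ∀ y ∈ S, (Finset.univ.filter fun i => y ∈ N i).card = d :=
      fun y hy => hN y (Finset.mem_insert_of_mem hy)
    rw [Finset.sum_powerset_insert hx]
    set f' : ι → Finset α → ℝ := fun i a => f i (if x ∈ N i then insert x a else a) with hf'
    have h1 := ih hN' f hf
    have h2 := ih hN' f' (fun i a => hf _ _)
    have h2' : ∑ A ∈ S.powerset, ∏ i, f i (insert x A ∩ N i) =
        ∑ A ∈ S.powerset, ∏ i, f' i (A ∩ N i) := by
      refine Finset.sum_congr rfl fun A _ => Finset.prod_congr rfl fun i _ => ?_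
      by_cases h : x ∈ N i
      · simp [hf', h, Finset.insert_inter_of_mem]
      · simp [hf', h, Finset.insert_inter_of_notMem]
    rw [h2']
    refine (add_le_add h1 h2).trans ?_
    set T : Finset ι := (Finset.univ.filter fun i => x ∈ N i) with hT
    have hTc : T.card = d := hN x (Finset.mem_insert_self _ _)
    have hmem : ∀ i, i ∈ T ↔ x ∈ N i := fun i => by simp [hT]
    classical
    rw [← Finset.prod_mul_prod_compl T, ← Finset.prod_mul_prod_compl T,
      ← Finset.prod_mul_prod_compl T (fun i => (∑ a ∈ (insert x S ∩ N i).powerset, _) ^ _)]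
    have hc : ∏ i ∈ Tᶜ, (∑ a ∈ (S ∩ N i).powerset, f' i a ^ d) ^ (1 / (d : ℝ)) =
        ∏ i ∈ Tᶜ, (∑ a ∈ (S ∩ N i).powerset, f i a ^ d) ^ (1 / (d : ℝ)) := by
      refine Finset.prod_congr rfl fun i hi => ?_
      rw [Finset.mem_compl, hmem] at hi
      simp [hf', hi]
    have hc' : ∏ i ∈ Tᶜ, (∑ a ∈ (insert x S ∩ N i).powerset, f i a ^ d) ^ (1 / (d : ℝ)) =
        ∏ i ∈ Tᶜ, (∑ a ∈ (S ∩ N i).powerset, f i a ^ d) ^ (1 / (d : ℝ)) := by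
      refine Finset.prod_congr rfl fun i hi => ?_
      rw [Finset.mem_compl, hmem] at hi
      rw [Finset.insert_inter_of_notMem hi]
    have hi' : ∏ i ∈ T, (∑ a ∈ (insert x S ∩ N i).powerset, f i a ^ d) ^ (1 / (d : ℝ)) =
        ∏ i ∈ T, (∑ a ∈ (S ∩ N i).powerset, f i a ^ d +
          ∑ a ∈ (S ∩ N i).powerset, f' i a ^ d) ^ (1 / (d : ℝ)) := by
      refine Finset.prod_congr rfl fun i hi => ?_
      rw [hmem] at hi
      rw [Finset.insert_inter_of_mem hi, Finset.sum_powerset_insert (by simp [hx])]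
      simp [hf', hi]
    rw [hc, hc', hi', ← add_mul]
    refine mul_le_mul_of_nonneg_right ?_
      (Finset.prod_nonneg fun i _ => Real.rpow_nonneg
        (Finset.sum_nonneg fun a _ => pow_nonneg (hf _ _).le _) _)
    have := Real.prod_rpow_add_prod_rpow_le T
      (fun i => ∑ a ∈ (S ∩ N i).powerset, f i a ^ d)
      (fun i => ∑ a ∈ (S ∩ N i).powerset, f' i a ^ d)
      (Finset.card_pos.mp (by omega))
      (fun i _ => Finset.sum_pos (fun a _ => pow_pos (hf _ _) _)
        ⟨∅, Finset.empty_mem_powerset _⟩)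
      (fun i _ => Finset.sum_pos (fun a _ => pow_pos (hf _ _) _)
        ⟨∅, Finset.empty_mem_powerset _⟩)
    rwa [hTc] at this

theorem Finset.card_powerset_filter_card_le {α : Type*} (X : Finset α) (s : ℕ) :
    (X.powerset.filter fun a => a.card ≤ s).card ≤ (X.card + 1) ^ s := by
  classical
  have h : X.powerset.filter (fun a => a.card ≤ s) =
      (Finset.range (s + 1)).biUnion fun i => X.powersetCard i := by
    ext a
    simp only [Finset.mem_filter, Finset.mem_powerset, Finset.mem_biUnion, Finset.mem_range,
      Finset.mem_powersetCard, Nat.lt_succ_iff]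
    constructor
    · rintro ⟨h1, h2⟩
      exact ⟨_, h2, h1, rfl⟩
    · rintro ⟨i, hi, h1, rfl⟩
      exact ⟨h1, hi⟩
  rw [h, add_pow]
  refine Finset.card_biUnion_le.trans (Finset.sum_le_sum fun i hi => ?_)
  rw [Finset.card_powersetCard, one_pow, mul_one]
  have : 1 ≤ s.choose i := Nat.choose_pos (by simpa [Nat.lt_succ_iff] using hi)
  calc X.card.choose i ≤ X.card ^ i := Nat.choose_le_pow _ _
    _ ≤ _ := Nat.le_mul_of_pos_right _ this

/-! ### Counting sets of bounded induced degree -/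

namespace SimpleGraph

variable {V : Type*} (G : SimpleGraph V)

/-- A vertex set in which every vertex has at most `t` neighbours. -/
def IsDegreeBounded [DecidableRel G.Adj] (t : ℕ) (A : Finset V) : Prop :=
  ∀ v ∈ A, (A.filter (G.Adj v)).card ≤ t

variable [DecidableRel G.Adj]

instance instDecidablePredIsDegreeBounded [DecidableEq V] (t : ℕ) :
    DecidablePred (G.IsDegreeBounded t) := fun _ => by
  unfold IsDegreeBounded; infer_instance

variable {G} in
theorem IsDegreeBounded.card_filter_adj_le [DecidableEq V] {t : ℕ} {A B C : Finset V}
    (hA : G.IsDegreeBounded t A) (hB : G.IsDegreeBounded t B) {v : V} (hvA : v ∈ A) (hvB : v ∈ B) (h : C ⊆ A ∪ B) :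
    (C.filter (G.Adj v)).card ≤ 2 * t := by
  have h1 : C.filter (G.Adj v) ⊆ A.filter (G.Adj v) ∪ B.filter (G.Adj v) := by
    rw [← Finset.filter_union]; exact Finset.filter_subset_filter _ h
  have h2 := (Finset.card_le_card h1).trans (Finset.card_union_le _ _)
  have := hA v hvA
  have := hB v hvB
  omega

variable {G} in
theorem IsDegreeBounded.mono {t : ℕ} {A B : Finset V} (hA : G.IsDegreeBounded t A) (h : B ⊆ A) :
    G.IsDegreeBounded t B := fun v hv =>
  (Finset.card_le_card (Finset.filter_subset_filter _ h)).trans (hA v (h hv))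

theorem sum_card_filter_adj_eq_twice_ncard_edgeSet_induce (J : Finset V) :
    ∑ v ∈ J, (J.filter (G.Adj v)).card = 2 * (G.induce (J : Set V)).edgeSet.ncard := by
  classical
  have h := (G.induce (J : Set V)).sum_degrees_eq_twice_card_edges
  rw [Set.ncard_eq_toFinset_card', ← edgeFinset, ← h, ← Finset.sum_coe_sort]
  refine Finset.sum_congr rfl fun v _ => ?_
  rw [← card_neighborFinset_eq_degree]
  symm
  refine Finset.card_bij (fun w _ => (w : V)) ?_ ?_ ?_
  · intro w hw
    simpa using hw
  · intro a _ b _ hab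
    exact Subtype.ext hab
  · intro b hb
    simp only [Finset.mem_filter] at hb
    exact ⟨⟨b, hb.1⟩, by simpa using hb.2, rfl⟩

variable [Fintype V] [DecidableEq V]

open scoped symmDiff in
/-- A form of Zhao's bipartite swapping trick. -/
theorem sq_card_isDegreeBounded_le (t : ℕ) :
    (Finset.univ.filter (G.IsDegreeBounded t)).card ^ 2 ≤
      (Finset.univ.filter fun P : Finset V × Finset V =>
        ∀ v ∈ P.2, (P.1.filter (G.Adj v)).card ≤ 2 * t).card := by
  -- The splitting `W` depends on `A ∆ B` alone. Swapping along `W` preserves `A ∆ B`, so `W` can be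
  -- recovered and the swap is injective.
  have hW : ∀ U : Finset V, ∃ W ⊆ U, (∃ A B, G.IsDegreeBounded t A ∧ G.IsDegreeBounded t B ∧
      A ∆ B = U) → G.IsDegreeBounded t W ∧ G.IsDegreeBounded t (U \ W) := by
    intro U
    by_cases h : ∃ A B, G.IsDegreeBounded t A ∧ G.IsDegreeBounded t B ∧ A ∆ B = U
    · obtain ⟨A, B, hA, hB, rfl⟩ := h
      refine ⟨A \ B, le_sup_left, fun _ => ⟨hA.mono Finset.sdiff_subset, hB.mono ?_⟩⟩
      intro v
      simp only [Finset.mem_sdiff, Finset.mem_symmDiff]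
      tauto
    · exact ⟨∅, by simp, fun h' => absurd h' h⟩
  choose W hWU hW using hW
  rw [sq, ← Finset.card_product]
  refine Finset.card_le_card_of_injOn (fun P => (P.1 ∆ W (P.1 ∆ P.2), P.2 ∆ W (P.1 ∆ P.2))) ?_ ?_
  · rintro ⟨A, B⟩ hAB
    simp only [Finset.coe_product, Finset.coe_filter, Finset.mem_univ, true_and, Set.mem_prod,
      Set.mem_ofPred_eq] at hAB ⊢
    obtain ⟨hA, hB⟩ := hAB
    obtain ⟨h1, h2⟩ := hW (A ∆ B) ⟨A, B, hA, hB, rfl⟩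
    have hU := hWU (A ∆ B)
    generalize W (A ∆ B) = Z at *
    have hU' : ∀ x ∈ Z, (x ∈ A ∧ x ∉ B ∨ x ∈ B ∧ x ∉ A) := fun x hx => by
      simpa [Finset.mem_symmDiff] using hU hx
    intro v hv
    have hsub : ∀ {C : Finset V}, (∀ x, x ∈ A ∆ Z → x ∈ C) → A ∆ Z ⊆ C := fun h x hx => h x hx
    rw [Finset.mem_symmDiff] at hv
    by_cases hvA : v ∈ A
    · by_cases hvB : v ∈ B
      · refine hA.card_filter_adj_le hB hvA hvB (hsub fun x => ?_)
        have := hU' x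
        simp only [Finset.mem_symmDiff, Finset.mem_union]
        tauto
      · refine hA.card_filter_adj_le h1 hvA (by tauto) (hsub fun x => ?_)
        simp only [Finset.mem_symmDiff, Finset.mem_union]
        tauto
    · have hvB : v ∈ B := by have := hU' v; tauto
      refine hB.card_filter_adj_le h2 hvB ?_ (hsub fun x => ?_)
      · simp only [Finset.mem_symmDiff, Finset.mem_sdiff]; tauto
      · have := hU' x
        simp only [Finset.mem_symmDiff, Finset.mem_union, Finset.mem_sdiff]
        tauto
  · rintro ⟨A, B⟩ - ⟨A', B'⟩ - h
    simp only [Prod.mk.injEq] at h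
    obtain ⟨h1, h2⟩ := h
    have h3 : A ∆ B = A' ∆ B' := by
      have := congrArg₂ (· ∆ ·) h1 h2
      simpa only [symmDiff_symmDiff_symmDiff_comm, symmDiff_self, symmDiff_bot] using this
    rw [h3] at h1 h2
    exact Prod.ext (symmDiff_left_injective _ h1) (symmDiff_left_injective _ h2)

theorem sq_card_isDegreeBounded_le_rpow {d : ℕ} (hd : 1 ≤ d)
    (hG : ∀ v, (Finset.univ.filter (G.Adj v)).card = d) (t : ℕ) :
    ((Finset.univ.filter (G.IsDegreeBounded t)).card : ℝ) ^ 2 ≤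
      (((2 : ℝ) ^ (d + 1) * ((d : ℝ) + 1) ^ (2 * t)) ^ (1 / (d : ℝ))) ^ Fintype.card V := by
  set N : V → Finset V := fun v => Finset.univ.filter (G.Adj v) with hN
  -- Weight 2 marks the vertices free to lie in `B` or not once `A` is fixed, so the product over
  -- `v` counts the admissible `B`.
  set f : V → Finset V → ℝ := fun _ a => if a.card ≤ 2 * t then 2 else 1 with hf
  have hfpos : ∀ v a, 0 < f v a := fun v a => by simp only [hf]; split_ifs <;> norm_num
  have h1 : ((Finset.univ.filter fun P : Finset V × Finset V =>
        ∀ v ∈ P.2, (P.1.filter (G.Adj v)).card ≤ 2 * t).card : ℝ) =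
      ∑ A ∈ (Finset.univ : Finset V).powerset, ∏ v, f v (A ∩ N v) := by
    rw [Finset.card_filter, ← Finset.univ_product_univ, Finset.sum_product, Nat.cast_sum,
      Finset.powerset_univ]
    refine Finset.sum_congr rfl fun A _ => ?_
    rw [← Finset.card_filter]
    have : (Finset.univ.filter fun B : Finset V => ∀ v ∈ B, (A.filter (G.Adj v)).card ≤ 2 * t) =
        (Finset.univ.filter fun v => (A.filter (G.Adj v)).card ≤ 2 * t).powerset := by
      ext B
      simp [Finset.subset_iff]
    rw [this, Finset.card_powerset]
    have hAN : ∀ v, A ∩ N v = A.filter (G.Adj v) := fun v => by ext; simp [hN]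
    simp [hf, hAN, Finset.prod_ite]
  have h2 := Finset.sum_powerset_prod_le_prod_rpow N d hd Finset.univ
    (fun x _ => by simpa [hN, G.adj_comm _ x] using hG x) f hfpos
  have h3 : ∀ v, (∑ a ∈ (Finset.univ ∩ N v).powerset, f v a ^ d) ≤
      (2 : ℝ) ^ (d + 1) * ((d : ℝ) + 1) ^ (2 * t) := by
    intro v
    rw [Finset.univ_inter]
    have hle : ∀ a, f v a ^ d ≤ 1 + (if a.card ≤ 2 * t then (2 : ℝ) ^ d else 0) := by
      intro a
      simp only [hf]
      split_ifs <;> simp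
    have hc := Finset.card_powerset_filter_card_le (N v) (2 * t)
    rw [show (N v).card = d from hG v] at hc
    have hc' : (((N v).powerset.filter fun a => a.card ≤ 2 * t).card : ℝ) ≤
        ((d : ℝ) + 1) ^ (2 * t) := by exact_mod_cast hc
    have hone : (1 : ℝ) ≤ ((d : ℝ) + 1) ^ (2 * t) :=
      one_le_pow₀ (by linarith [d.cast_nonneg (α := ℝ)])
    calc ∑ a ∈ (N v).powerset, f v a ^ d
        ≤ ∑ a ∈ (N v).powerset, (1 + (if a.card ≤ 2 * t then (2 : ℝ) ^ d else 0)) :=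
          Finset.sum_le_sum fun a _ => hle a
      _ = (2 : ℝ) ^ d + ((N v).powerset.filter fun a => a.card ≤ 2 * t).card * (2 : ℝ) ^ d := by
          rw [Finset.sum_add_distrib, ← Finset.sum_filter]
          simp [show (N v).card = d from hG v]
      _ ≤ (2 : ℝ) ^ d * ((d : ℝ) + 1) ^ (2 * t) + ((d : ℝ) + 1) ^ (2 * t) * (2 : ℝ) ^ d := by
          gcongr
          exact le_mul_of_one_le_right (by positivity) hone
      _ = _ := by ring
  calc ((Finset.univ.filter (G.IsDegreeBounded t)).card : ℝ) ^ 2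
      ≤ ((Finset.univ.filter fun P : Finset V × Finset V =>
        ∀ v ∈ P.2, (P.1.filter (G.Adj v)).card ≤ 2 * t).card : ℝ) := by
        exact_mod_cast G.sq_card_isDegreeBounded_le t
    _ ≤ ∏ v, (∑ a ∈ (Finset.univ ∩ N v).powerset, f v a ^ d) ^ (1 / (d : ℝ)) := h1.trans_le h2
    _ ≤ ∏ _v : V, ((2 : ℝ) ^ (d + 1) * ((d : ℝ) + 1) ^ (2 * t)) ^ (1 / (d : ℝ)) := by
        have hs : ∀ v, 0 ≤ ∑ a ∈ (Finset.univ ∩ N v).powerset, f v a ^ d := fun v =>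
          Finset.sum_nonneg fun a _ => pow_nonneg (hfpos v a).le _
        exact Finset.prod_le_prod (fun v _ => Real.rpow_nonneg (hs v) _)
          fun v _ => Real.rpow_le_rpow (hs v) (h3 v) (by positivity)
    _ = _ := by simp [Finset.prod_const, Finset.card_univ]

theorem card_isDegreeBounded_le_two_rpow {d : ℕ} (hd : 1 ≤ d)
    (hG : ∀ v, (Finset.univ.filter (G.Adj v)).card = d) (t : ℕ) (L : ℝ)
    (hL : (d : ℝ) + 1 ≤ 2 ^ L) :
    ((Finset.univ.filter (G.IsDegreeBounded t)).card : ℝ) ≤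
      2 ^ ((Fintype.card V : ℝ) / 2 * (1 + 1 / d + 2 * t * L / d)) := by
  have hd0 : (0 : ℝ) < d := by exact_mod_cast hd
  refine (pow_le_pow_iff_left₀ (Nat.cast_nonneg _) (by positivity) two_ne_zero).mp ?_
  refine (G.sq_card_isDegreeBounded_le_rpow hd hG t).trans ?_
  have h1 : (2 : ℝ) ^ (d + 1) * ((d : ℝ) + 1) ^ (2 * t) ≤ 2 ^ ((d : ℝ) + 1 + 2 * t * L) := by
    rw [Real.rpow_add two_pos]
    have e1 : (2 : ℝ) ^ ((d : ℝ) + 1) = 2 ^ (d + 1) := by exact_mod_cast Real.rpow_natCast 2 (d + 1)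
    have e2 : (2 : ℝ) ^ (2 * t * L) = (2 ^ L) ^ (2 * t) := by
      rw [← Real.rpow_mul_natCast two_pos.le]; push_cast; ring_nf
    rw [e1, e2]
    gcongr
  calc _ ≤ (((2 : ℝ) ^ ((d : ℝ) + 1 + 2 * t * L)) ^ (1 / (d : ℝ))) ^ Fintype.card V := by
        gcongr
    _ = _ := by
        rw [← Real.rpow_mul two_pos.le, ← Real.rpow_mul_natCast two_pos.le,
          ← Real.rpow_mul_natCast two_pos.le]
        congr 1
        push_cast
        field_simp

/-- Sets inducing few edges split into a set of small induced degrees and a small set. -/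
theorem card_filter_ncard_edgeSet_induce_le (t m : ℕ) (p : Finset V → Prop) [DecidablePred p]
    (hp : ∀ J, p J → ∀ R ⊆ J, (∀ v ∈ R, t < (J.filter (G.Adj v)).card) → R.card ≤ m) :
    (Finset.univ.filter p).card ≤
      (Finset.univ.filter (G.IsDegreeBounded t)).card * (Fintype.card V + 1) ^ m := by
  refine le_trans ?_ (Nat.mul_le_mul_left _
    (Finset.card_powerset_filter_card_le (Finset.univ : Finset V) m))
  rw [← Finset.card_product]
  refine Finset.card_le_card_of_injOn (fun J => (J.filter fun v => (J.filter (G.Adj v)).card ≤ t,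
    J.filter fun v => ¬ (J.filter (G.Adj v)).card ≤ t)) ?_ ?_
  · intro J hJ
    simp only [Finset.coe_filter, Finset.mem_univ, true_and, Set.mem_ofPred_eq] at hJ
    simp only [Finset.coe_product, Finset.coe_filter, Set.mem_prod, Set.mem_ofPred_eq,
      Finset.mem_univ, true_and, Finset.powerset_univ]
    refine ⟨fun v hv => ?_, hp J hJ _ (Finset.filter_subset _ _) fun v hv => ?_⟩
    · exact (Finset.card_le_card (Finset.filter_subset_filter _ (Finset.filter_subset _ _))).trans
        (Finset.mem_filter.mp hv).2
    · exact not_le.mp (Finset.mem_filter.mp hv).2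
  · intro J _ J' _ h
    simp only [Prod.mk.injEq] at h
    rw [← Finset.filter_union_filter_not_eq (fun v => (J.filter (G.Adj v)).card ≤ t) J, h.1, h.2,
      Finset.filter_union_filter_not_eq]

end SimpleGraph

/-! ### From edge density to the final count -/

theorem two_mul_ncard_edgeSet_induce_le_of_inducedDensity_le {V : Type*} [Fintype V] [Nonempty V]
    {G : SimpleGraph V} {J : Finset V} {k d : ℝ} (hk : 0 < k) (hd : 0 ≤ d)
    (h : inducedDensity G J ≤ (1 / k) * (d / Fintype.card V)) :
    2 * ((G.induce (J : Set V)).edgeSet.ncard : ℝ) ≤ d * Fintype.card V / k := by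
  classical
  have hn : (0 : ℝ) < Fintype.card V := by exact_mod_cast Fintype.card_pos
  unfold inducedDensity at h
  -- For `|J| ≤ 1` the density is a division by zero and carries no information; the absence of
  -- edges is checked directly.
  rcases (Nat.eq_zero_or_pos (J.card.choose 2)) with h0 | h0
  · have hJ : J.card ≤ 1 := by
      rw [Nat.choose_eq_zero_iff] at h0; omega
    have : (G.induce (J : Set V)).edgeSet.ncard = 0 := by
      have := G.sum_card_filter_adj_eq_twice_ncard_edgeSet_induce J
      have hz : ∑ v ∈ J, (J.filter (G.Adj v)).card = 0 := by
        refine Finset.sum_eq_zero fun v hv => ?_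
        rw [Finset.card_eq_zero, Finset.filter_eq_empty_iff]
        intro w hw hvw
        exact hvw.ne (Finset.card_le_one.mp hJ v hv w hw)
      omega
    rw [this]
    simp only [Nat.cast_zero, mul_zero]
    positivity
  · rw [div_le_iff₀ (by exact_mod_cast h0)] at h
    have h2 : 2 * ((J.card.choose 2 : ℕ) : ℝ) ≤ (Fintype.card V : ℝ) ^ 2 := by
      rw [Nat.cast_choose_two]
      have h3 : (J.card : ℝ) ≤ Fintype.card V := by exact_mod_cast Finset.card_le_univ J
      have h4 : (0 : ℝ) ≤ J.card := Nat.cast_nonneg _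
      nlinarith
    calc 2 * ((G.induce (J : Set V)).edgeSet.ncard : ℝ)
        ≤ (1 / k) * (d / Fintype.card V) * (2 * ((J.card.choose 2 : ℕ) : ℝ)) := by linarith
      _ ≤ (1 / k) * (d / Fintype.card V) * (Fintype.card V : ℝ) ^ 2 := by gcongr
      _ = _ := by field_simp

theorem theorem3 :
    ∃ c C₁ C₂ : ℝ, 0 < c ∧ 0 < C₁ ∧ 0 < C₂ ∧
      ∀ (V : Type*) [Fintype V] [Nonempty V] (G : SimpleGraph V) [G.LocallyFinite] (n d : ℕ) (k : ℝ),
        Fintype.card V = n → 1 ≤ d → G.IsRegularOfDegree d →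
        c * (Real.logb 2 n) ^ 9 ≤ k →
        (({J : Finset V | inducedDensity G J ≤ (1 / k) * ((d : ℝ) / (n : ℝ))}.ncard : ℕ) : ℝ) ≤
          (2 : ℝ) ^ (((n : ℝ) / 2) *
            (1 + C₁ * ((Real.logb 2 n) ^ 3 / (d : ℝ))
               + C₂ * ((Real.logb 2 n) ^ 3 / k ^ ((1 : ℝ) / 3)))) := by
  -- The bound on `k` serves only to give `k ≥ 1`. In 6 = 2 + 4, the 2 comes from the degree bound
  -- `t` and the 4 from the exceptional vertices.
  refine ⟨1, 1, 6, one_pos, one_pos, by norm_num, ?_⟩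
  intro V _ _ G _ n d k hn hd hreg hk
  classical
  subst hn
  set n := Fintype.card V with hn
  have hG : ∀ v, (Finset.univ.filter (G.Adj v)).card = d := fun v => by
    rw [← hreg v, ← SimpleGraph.card_neighborFinset_eq_degree]
    congr 1
    ext w
    simp
  have hdn : d + 1 ≤ n := by
    obtain ⟨v⟩ := ‹Nonempty V›
    rw [← hG v, hn, ← Finset.card_univ, Nat.succ_le_iff]
    exact Finset.card_lt_card (Finset.filter_ssubset.mpr ⟨v, Finset.mem_univ v, G.irrefl⟩)
  have hn2 : (2 : ℝ) ≤ n := by exact_mod_cast (by omega : 2 ≤ n)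
  have hn0 : (0 : ℝ) < n := by linarith
  have hd0 : (0 : ℝ) < d := by exact_mod_cast hd
  set L := Real.logb 2 n with hL
  have hnL : (2 : ℝ) ^ L = n := Real.rpow_logb two_pos (by norm_num) hn0
  have hL1 : 1 ≤ L := by
    rw [hL, Real.le_logb_iff_rpow_le one_lt_two hn0, Real.rpow_one]; exact hn2
  have hk1 : 1 ≤ k := by
    rw [one_mul] at hk; exact (one_le_pow₀ hL1).trans hk
  set κ := k ^ ((1 : ℝ) / 3) with hκ
  have hκ1 : 1 ≤ κ := Real.one_le_rpow hk1 (by norm_num)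
  have hκ0 : 0 < κ := by linarith
  have hκ3 : κ ^ 3 = k := by
    rw [hκ, ← Real.rpow_mul_natCast (by linarith)]; norm_num
  set t := ⌊(d : ℝ) / κ ^ 2⌋₊ with ht
  set m := ⌊(n : ℝ) / κ⌋₊ with hm
  have htle : (t : ℝ) ≤ d / κ ^ 2 := Nat.floor_le (by positivity)
  have hmle : (m : ℝ) ≤ n / κ := Nat.floor_le (by positivity)
  have hcount := G.card_filter_ncard_edgeSet_induce_le t m
    (fun J => inducedDensity G J ≤ (1 / k) * ((d : ℝ) / (n : ℝ))) (by
      intro J hJ R hR hRt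
      have he := two_mul_ncard_edgeSet_induce_le_of_inducedDensity_le (by linarith) hd0.le hJ
      have hsum : (∑ v ∈ J, ((J.filter (G.Adj v)).card : ℝ)) ≤ d * n / k := by
        refine le_trans (le_of_eq ?_) he
        exact_mod_cast G.sum_card_filter_adj_eq_twice_ncard_edgeSet_induce J
      have hRsum : (R.card : ℝ) * (d / κ ^ 2) ≤ d * n / k := by
        refine le_trans ?_ ((Finset.sum_le_sum_of_subset_of_nonneg hR
          fun _ _ _ => Nat.cast_nonneg _).trans hsum)
        rw [← nsmul_eq_mul]
        exact Finset.card_nsmul_le_sum _ _ _ fun v hv => ((Nat.floor_lt (by positivity)).mp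
          (hRt v hv)).le
      refine Nat.le_floor ?_
      rw [le_div_iff₀ hκ0]
      rw [← hκ3, ← mul_div_assoc, div_le_div_iff₀ (by positivity) (by positivity)] at hRsum
      have : (R.card * κ) * (d * κ ^ 2) ≤ n * (d * κ ^ 2) := by linarith
      exact le_of_mul_le_mul_right this (by positivity))
  have hncard : {J : Finset V | inducedDensity G J ≤ (1 / k) * ((d : ℝ) / (n : ℝ))}.ncard =
      (Finset.univ.filter
        fun J : Finset V => inducedDensity G J ≤ (1 / k) * ((d : ℝ) / (n : ℝ))).card := by
    rw [← Set.ncard_coe_finset]; simp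
  have hN := G.card_isDegreeBounded_le_two_rpow hd hG t L (by rw [hnL]; exact_mod_cast hdn)
  -- The 2 in `2 * L` comes from `n + 1 ≤ n²`, valid as `n ≥ 2`.
  have hR : ((n : ℝ) + 1) ^ m ≤ 2 ^ (2 * L * (n / κ)) := by
    calc ((n : ℝ) + 1) ^ m ≤ ((2 : ℝ) ^ (2 * L)) ^ m := by
          gcongr
          rw [mul_comm, Real.rpow_mul two_pos.le, hnL, Real.rpow_two]
          nlinarith
      _ = 2 ^ (2 * L * m) := by rw [← Real.rpow_mul_natCast two_pos.le]
      _ ≤ _ := by gcongr; norm_num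
  rw [hncard]
  calc _ ≤ ((Finset.univ.filter (G.IsDegreeBounded t)).card : ℝ) * ((n : ℝ) + 1) ^ m := by
        exact_mod_cast hcount
    _ ≤ 2 ^ ((n : ℝ) / 2 * (1 + 1 / d + 2 * t * L / d)) * 2 ^ (2 * L * (n / κ)) := by gcongr
    _ = 2 ^ ((n : ℝ) / 2 * (1 + 1 / d + 2 * t * L / d) + 2 * L * (n / κ)) := by
        rw [Real.rpow_add two_pos]
    _ ≤ _ := by
        refine Real.rpow_le_rpow_of_exponent_le one_le_two ?_
        have hLL : L ≤ L ^ 3 := le_self_pow₀ hL1 (by norm_num)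
        have h1 : 1 / (d : ℝ) ≤ L ^ 3 / d := by gcongr; exact one_le_pow₀ hL1
        have h2 : 2 * t * L / d ≤ 2 * (L ^ 3 / κ) := by
          calc 2 * t * L / d ≤ 2 * (d / κ ^ 2) * L / d := by gcongr
            _ = 2 * (L / κ ^ 2) := by field_simp
            _ ≤ 2 * (L ^ 3 / κ) := by gcongr; exact le_self_pow₀ hκ1 (by norm_num)
        have h3 : L / κ ≤ L ^ 3 / κ := by gcongr
        calc _ = (n : ℝ) / 2 * (1 + 1 / d + 2 * t * L / d + 4 * (L / κ)) := by ring
          _ ≤ _ := by gcongr (n : ℝ) / 2 * ?_; linarith
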